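/- Call a set $S\subseteq\mathbb N$ eventually periodic if there exist natural numbers $\theta$ and $p>0$ such that for every $n\ge\theta$, if $n\in S$ then $n+p\in S$. Let $L$ be a vocabulary (with equality) in which every relation symbol other than equality is unary and which has exactly one function symbol, that symbol being unary (in particular there are no constant symbols); the number of unary relation symbols is arbitrary. Let $\varphi$ be a monadic second-order formula over $L$, that is, a formula built from atomic formulas $t_1=t_2$, $R(t)$ and $t\in X$ (with $t,t_1,t_2$ terms of $L$, $R$ a relation symbol of $L$, and $X$ a set variable) by Boolean connectives, quantifiers over elements, and quantifiers over arbitrary sets of elements. The spectrum of $\varphi$ is the set of cardinalities of the finite models of $\varphi$, where a model is a nonempty $L$-structure, together with values for the free element and set variables of $\varphi$ if there are any, that satisfies $\varphi$. Then the spectrum of $\varphi$ is eventually periodic. -/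

import Mathlib

universe u v

namespace MSO

/-- Monadic second-order formulas over a first-order language `L`, with free individual variables
indexed by `Fin n` and free set variables indexed by `Fin k`. Equality, falsum, implication and the
two universal quantifiers are primitive; the other connectives and the existential quantifiers are
definable from them classically. In `all` and `allSet` the bound variable is the one with the
last index. -/
inductive MSOFormula (L : FirstOrder.Language.{u, v}) : ℕ → ℕ → Type (max u v)
  | falsum {n k : ℕ} : MSOFormula L n k
  | equal {n k : ℕ} (t₁ t₂ : L.Term (Fin n)) : MSOFormula L n k
  | rel {n k l : ℕ} (R : L.Relations l) (ts : Fin l → L.Term (Fin n)) : MSOFormula L n k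
  | mem {n k : ℕ} (t : L.Term (Fin n)) (X : Fin k) : MSOFormula L n k
  | imp {n k : ℕ} (φ ψ : MSOFormula L n k) : MSOFormula L n k
  | all {n k : ℕ} (φ : MSOFormula L (n + 1) k) : MSOFormula L n k
  | allSet {n k : ℕ} (φ : MSOFormula L n (k + 1)) : MSOFormula L n k

/-- Satisfaction of a formula in a structure `M`, where `x` gives the values of the free individual
variables and `A` those of the free set variables. Individual quantifiers range over all elements
of `M`, set quantifiers over all subsets of `M`. -/
def MSOFormula.Realize {L : FirstOrder.Language.{u, v}} {M : Type} [L.Structure M] :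
    {n k : ℕ} → MSOFormula L n k → (Fin n → M) → (Fin k → Set M) → Prop
  | _, _, .falsum, _, _ => False
  | _, _, .equal t₁ t₂, x, _ => t₁.realize x = t₂.realize x
  | _, _, .rel R ts, x, _ => FirstOrder.Language.Structure.RelMap R fun i => (ts i).realize x
  | _, _, .mem t X, x, A => t.realize x ∈ A X
  | _, _, .imp φ ψ, x, A => φ.Realize x A → ψ.Realize x A
  | n, _, .all φ, x, A => ∀ a : M, φ.Realize (Fin.snoc (α := fun _ : Fin (n + 1) => M) x a) A
  | _, k, .allSet φ, x, A =>
      ∀ B : Set M, φ.Realize x (Fin.snoc (α := fun _ : Fin (k + 1) => Set M) A B)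

/-- The spectrum of a formula: the set of cardinalities of its finite models. A model of a formula
is a nonempty structure together with values of the free variables (if there are any) that
satisfies the formula. -/
def MSOFormula.spectrum {L : FirstOrder.Language.{u, v}} {n k : ℕ} (φ : MSOFormula L n k) : Set ℕ :=
  {c | ∃ (M : Type) (_ : Nonempty M) (_ : Finite M) (_ : L.Structure M)
      (x : Fin n → M) (A : Fin k → Set M), φ.Realize x A ∧ Nat.card M = c}

/-- A set of natural numbers is eventually periodic if, for some `p > 0`, it is closed under
adding `p` from some point on. -/
def EventuallyPeriodic (S : Set ℕ) : Prop :=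
  ∃ θ p : ℕ, 0 < p ∧ ∀ n, θ ≤ n → n ∈ S → n + p ∈ S

end MSO

/-!
The proof is a pumping argument based on a composition theorem for monadic second-order types.

A unary function on a finite set is viewed as a special *pointed partial function*: a partial map
`f : A → Option A` with a distinguished point. Two of these can be *glued* (`IsGluing`): in the
disjoint union, all undefined values of a part may be redirected to the distinguished point of one
of the parts. Every finite unary function is obtained from one-element partial functions by
repeated gluing (`exists_constructible`): components are put together by disjoint unions, a
component is a cycle element `r` glued to the forest left when `r` is removed, and forests are
built from their roots.

The `m`-type (`mtype`) of a tuple of subsets describes the tuple up to `m` set quantifiers. For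
finitely many sets there are finitely many `m`-types, and the `m`-types of the parts determine that
of a gluing (`IsGluing.mtype_eq`). Individual variables are represented by singletons, relation
symbols by their extensions; for suitable `m` the `m`-type then determines whether a given formula
holds (`exists_realize_iff`).

Thus the sizes of models are the numbers of leaves of terms in a finite algebra of types whose
values lie in a given set. A large term has a branch on which a value repeats, so the part between
the two occurrences can be repeated at will; a common multiple `p` of the sizes of such parts works
for all large terms (`exists_forall_gen_add`).
-/

universe w

namespace MSO

open FirstOrder Set

/-! ### Pumping for finite algebras -/

/-- The pairs `(t, n)` such that `t` is the value of a term with `n` leaves, all leaves having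
values in `base` and all inner nodes being binary operations `op o`. -/
inductive Gen {T O : Type*} (base : Set T) (op : O → T → T → T) : T → ℕ → Prop
  | leaf {t : T} (h : t ∈ base) : Gen base op t 1
  | node {a b : T} {i j : ℕ} (o : O) (ha : Gen base op a i) (hb : Gen base op b j) :
      Gen base op (op o a b) (i + j)

section Pumping

variable {T O : Type*} (base : Set T) (op : O → T → T → T)

/-- The effect on values and sizes of a context of size `d` leading from `a` to `b`: every size
of `a` yields, after adding `d`, a size of `b`. -/
def Shift (a b : T) (d : ℕ) : Prop :=
  0 < d ∧ ∀ n, Gen base op a n → Gen base op b (n + d)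

variable {base op}

theorem Gen.pos {a : T} {n : ℕ} (h : Gen base op a n) : 0 < n := by
  induction h <;> omega

theorem Shift.trans {a b c : T} {d e : ℕ} (h : Shift base op a b d) (h' : Shift base op b c e) :
    Shift base op a c (d + e) :=
  ⟨by have := h.1; omega, fun n hn => by rw [← add_assoc]; exact h'.2 _ (h.2 _ hn)⟩

theorem Shift.iterate {a : T} {d : ℕ} (h : Shift base op a a d) (k : ℕ) {n : ℕ}
    (hn : Gen base op a n) : Gen base op a (n + d * k) := by
  induction k with
  | zero => simpa using hn
  | succ k ih => rw [Nat.mul_succ, ← add_assoc]; exact h.2 _ ih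

/-- Pumping: a large term has a value repeating on a branch, and the contexts that can be repeated
have a common multiple `p` of their sizes. -/
theorem exists_forall_gen_add (base : Set T) (op : O → T → T → T) [Finite T] :
    ∃ θ p : ℕ, 0 < p ∧ ∀ t n, θ ≤ n → Gen base op t n → Gen base op t (n + p) := by
  classical
  have := Fintype.ofFinite T
  let loop : T → ℕ := fun t => if h : ∃ d, Shift base op t t d then h.choose else 1
  have loop_spec : ∀ t, (∃ d, Shift base op t t d) → Shift base op t t (loop t) := by
    intro t h
    simp only [loop, dif_pos h]
    exact h.choose_spec
  have loop_pos : ∀ t, 0 < loop t := by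
    intro t
    by_cases h : ∃ d, Shift base op t t d
    · exact (loop_spec t h).1
    · simp [loop, dif_neg h]
  let p := ∏ t, loop t
  -- Terms that cannot be pumped have depth bounded by the number of values below their own.
  let rank : T → ℕ := fun t => (Finset.univ.filter fun a => ∃ d, Shift base op a t d).card
  have rank_lt : ∀ a t d, Shift base op a t d → (¬ ∃ d, Shift base op a a d) →
      rank a + 1 ≤ rank t := by
    intro a t d h hl
    refine Finset.card_lt_card (Finset.ssubset_iff_subset_ne.2 ⟨?_, ?_⟩)
    · intro b hb
      simp only [Finset.mem_filter, Finset.mem_univ, true_and] at hb ⊢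
      obtain ⟨e, he⟩ := hb
      exact ⟨_, he.trans h⟩
    · intro he
      have : a ∈ Finset.univ.filter fun a => ∃ d, Shift base op a t d := by simpa using ⟨d, h⟩
      rw [← he] at this
      exact hl (by simpa using this)
  have pump : ∀ t n, (∃ d, Shift base op t t d) → Gen base op t n → Gen base op t (n + p) := by
    intro t n h hn
    obtain ⟨k, hk⟩ : loop t ∣ p := Finset.dvd_prod_of_mem loop (Finset.mem_univ t)
    rw [hk]
    exact (loop_spec t h).iterate k hn
  have key : ∀ t n, Gen base op t n → Gen base op t (n + p) ∨ n ≤ 2 ^ rank t := by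
    intro t n h
    induction h with
    | leaf h => exact Or.inr Nat.one_le_two_pow
    | @node a b i j o ha hb iha ihb =>
      have la : Gen base op a (i + p) → Gen base op (op o a b) (i + j + p) := fun h => by
        rw [add_right_comm]; exact h.node o hb
      have lb : Gen base op b (j + p) → Gen base op (op o a b) (i + j + p) := fun h => by
        rw [add_assoc]; exact ha.node o h
      by_cases hla : ∃ d, Shift base op a a d
      · exact Or.inl (la (pump a i hla ha))
      by_cases hlb : ∃ d, Shift base op b b d
      · exact Or.inl (lb (pump b j hlb hb))
      rcases iha with iha | iha
      · exact Or.inl (la iha)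
      rcases ihb with ihb | ihb
      · exact Or.inl (lb ihb)
      have ra := rank_lt a (op o a b) j ⟨hb.pos, fun n hn => hn.node o hb⟩ hla
      have rb := rank_lt b (op o a b) i
        ⟨ha.pos, fun n hn => by rw [add_comm]; exact ha.node o hn⟩ hlb
      have h1 := Nat.pow_le_pow_right (n := 2) (by norm_num) ra
      have h2 := Nat.pow_le_pow_right (n := 2) (by norm_num) rb
      rw [pow_succ] at h1 h2
      exact Or.inr (by omega)
  refine ⟨2 ^ Fintype.card T + 1, p, Finset.prod_pos fun t _ => loop_pos t, fun t n hn h => ?_⟩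
  rcases key t n h with h | h
  · exact h
  · have : 2 ^ rank t ≤ 2 ^ Fintype.card T :=
      Nat.pow_le_pow_right (by norm_num) (Finset.card_le_univ _)
    omega

end Pumping

/-! ### Monadic types of pointed partial functions -/

/-- The quantifier-free information about a tuple of subsets, indexed by `ι`, of a set with a
partial unary function and a distinguished point. -/
@[ext]
structure AtomicType (ι : Type*) where
  /-- The sets `i` and `j` meet. -/
  meet : ι → ι → Prop
  /-- The set `i` has at most one element. -/
  sub : ι → Prop
  /-- The function maps some element of the set `i` into the set `j`. -/
  edge : ι → ι → Prop
  /-- The function is undefined at some element of the set `i`. -/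
  undef : ι → Prop
  /-- The distinguished point belongs to the set `i`. -/
  start : ι → Prop

instance (ι : Type*) [Finite ι] : Finite (AtomicType ι) :=
  Finite.of_injective
    (fun a => (a.meet, a.sub, a.edge, a.undef, a.start)) (by
      rintro ⟨⟩ ⟨⟩ h
      simpa using h)

/-- The type of `m`-types of tuples of sets indexed by `ι`: an `(m + 1)`-type is the set of the
`m`-types of the extensions of the tuple by one more set. -/
def MType : ℕ → Type w → Type w
  | 0, ι => AtomicType ι
  | m + 1, ι => Set (MType m (Option ι))

instance finite_mType (m : ℕ) (ι : Type*) [Finite ι] : Finite (MType m ι) := by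
  induction m generalizing ι with
  | zero => exact inferInstanceAs (Finite (AtomicType ι))
  | succ m ih =>
    have := ih (Option ι)
    exact inferInstanceAs (Finite (Set (MType m (Option ι))))

/-- The extension of a tuple of sets by one more set, at the index `none`. -/
def extend {ι A : Type*} (X : ι → Set A) (B : Set A) : Option ι → Set A := fun o => o.elim B X

/-- The `m`-type of the tuple of sets `X` in the set `A` with partial function `f` and
distinguished point `s`. -/
def mtype {A : Type} (f : A → Option A) (s : A) :
    (m : ℕ) → {ι : Type w} → (ι → Set A) → MType m ι
  | 0, _, X => AtomicType.mk
      (fun i j => (X i ∩ X j).Nonempty)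
      (fun i => (X i).Subsingleton)
      (fun i j => ∃ x ∈ X i, ∃ y ∈ X j, f x = some y)
      (fun i => ∃ x ∈ X i, f x = none)
      (fun i => s ∈ X i)
  | m + 1, _, X => Set.range fun B => mtype f s m (extend X B)

section BackAndForth

variable {A A' : Type} {f : A → Option A} {s : A} {f' : A' → Option A'} {s' : A'} {m : ℕ}
  {ι κ : Type w} {X : ι → Set A} {X' : ι → Set A'}

theorem mtype_forth (h : mtype f s (m + 1) X = mtype f' s' (m + 1) X') (B : Set A) :
    ∃ B', mtype f s m (extend X B) = mtype f' s' m (extend X' B') := by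
  have h : Set.range (fun B => mtype f s m (extend X B)) =
      Set.range fun B' => mtype f' s' m (extend X' B') := h
  obtain ⟨B', hB'⟩ := h ▸ Set.mem_range_self B
  exact ⟨B', hB'.symm⟩

theorem mtype_succ_eq
    (h : ∀ B, ∃ B', mtype f s m (extend X B) = mtype f' s' m (extend X' B'))
    (h' : ∀ B', ∃ B, mtype f s m (extend X B) = mtype f' s' m (extend X' B')) :
    mtype f s (m + 1) X = mtype f' s' (m + 1) X' := by
  refine Set.Subset.antisymm ?_ ?_
  · rintro _ ⟨B, rfl⟩
    obtain ⟨B', hB⟩ := h B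
    exact ⟨B', hB.symm⟩
  · rintro _ ⟨B, rfl⟩
    obtain ⟨B', hB⟩ := h' B
    exact ⟨B', hB⟩

theorem extend_comp {A : Type*} {ι κ : Type*} (X : ι → Set A) (B : Set A) (g : κ → ι) :
    extend (X ∘ g) B = extend X B ∘ Option.map g := by
  funext o
  cases o <;> rfl

theorem mtype_comp (h : mtype f s m X = mtype f' s' m X') (g : κ → ι) :
    mtype f s m (X ∘ g) = mtype f' s' m (X' ∘ g) := by
  induction m generalizing ι κ with
  | zero =>
    have := congrArg (fun a : AtomicType ι => AtomicType.mk (fun i j => a.meet (g i) (g j))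
      (fun i => a.sub (g i)) (fun i j => a.edge (g i) (g j)) (fun i => a.undef (g i))
      (fun i => a.start (g i))) h
    exact this
  | succ m ih =>
    refine mtype_succ_eq (fun B => ?_) (fun B => ?_)
    · obtain ⟨B', hB⟩ := mtype_forth h B
      exact ⟨B', by rw [extend_comp, extend_comp]; exact ih hB _⟩
    · obtain ⟨B', hB⟩ := mtype_forth h.symm B
      exact ⟨B', by rw [extend_comp, extend_comp]; exact ih hB.symm _⟩

theorem mtype_of_succ (h : mtype f s (m + 1) X = mtype f' s' (m + 1) X') :
    mtype f s m X = mtype f' s' m X' := by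
  obtain ⟨B', hB⟩ := mtype_forth h ∅
  exact mtype_comp hB some

theorem mtype_of_le {m' : ℕ} (hm : m' ≤ m) (h : mtype f s m X = mtype f' s' m X') :
    mtype f s m' X = mtype f' s' m' X' := by
  induction hm with
  | refl => exact h
  | step _ ih => exact ih (mtype_of_succ h)

theorem mtype_zero (h : mtype f s m X = mtype f' s' m X') :
    mtype f s 0 X = mtype f' s' 0 X' :=
  mtype_of_le (Nat.zero_le m) h

theorem meet_iff (h : mtype f s m X = mtype f' s' m X') (i j : ι) :
    (X i ∩ X j).Nonempty ↔ (X' i ∩ X' j).Nonempty :=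
  iff_of_eq (congrArg (fun a : AtomicType ι => a.meet i j) (mtype_zero h))

theorem edge_iff (h : mtype f s m X = mtype f' s' m X') (i j : ι) :
    (∃ x ∈ X i, ∃ y ∈ X j, f x = some y) ↔ ∃ x ∈ X' i, ∃ y ∈ X' j, f' x = some y :=
  iff_of_eq (congrArg (fun a : AtomicType ι => a.edge i j) (mtype_zero h))

theorem undef_iff (h : mtype f s m X = mtype f' s' m X') (i : ι) :
    (∃ x ∈ X i, f x = none) ↔ ∃ x ∈ X' i, f' x = none :=
  iff_of_eq (congrArg (fun a : AtomicType ι => a.undef i) (mtype_zero h))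

theorem exists_eq_singleton (h : mtype f s m X = mtype f' s' m X') {i : ι} {a : A}
    (hi : X i = {a}) : ∃ a', X' i = {a'} := by
  have h1 : (X i).Subsingleton ↔ (X' i).Subsingleton :=
    iff_of_eq (congrArg (fun a : AtomicType ι => a.sub i) (mtype_zero h))
  have h2 := meet_iff h i i
  rw [inter_self, inter_self] at h2
  rw [hi] at h1 h2
  exact exists_eq_singleton_iff_nonempty_subsingleton.2
    ⟨h2.1 (singleton_nonempty a), h1.1 subsingleton_singleton⟩

end BackAndForth

/-! ### Gluing and the composition theorem -/

/-- The operation on atomic types induced by gluing, see `IsGluing`. -/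
def AtomicType.glue {ι : Type*} (α β : Option Bool) (γ : Bool) (a b : AtomicType ι) :
    AtomicType ι where
  meet i j := a.meet i j ∨ b.meet i j
  sub i := a.sub i ∧ b.sub i ∧ (¬ a.meet i i ∨ ¬ b.meet i i)
  edge i j := a.edge i j ∨ b.edge i j ∨
    (a.undef i ∧ ∃ t, α = some t ∧ cond t (a.start j) (b.start j)) ∨
    (b.undef i ∧ ∃ t, β = some t ∧ cond t (a.start j) (b.start j))
  undef i := (a.undef i ∧ α = none) ∨ (b.undef i ∧ β = none)
  start j := cond γ (a.start j) (b.start j)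

/-- The operation on `m`-types induced by gluing, see `IsGluing`. -/
def MType.glue (α β : Option Bool) (γ : Bool) :
    (m : ℕ) → {ι : Type w} → MType m ι → MType m ι → MType m ι
  | 0, _, a, b => AtomicType.glue α β γ a b
  | m + 1, _, a, b => Set.image2 (fun x y => MType.glue α β γ m x y) a b

/-- The pointed partial function `(f, s)` arises from `(g, u)` and `(h, v)` by taking the disjoint
union (identified with the domain of `f` along `e`) and redirecting undefined values: where `g` is
undefined, `f` is undefined if `α = none`, and otherwise takes the value `u` or `v`, the choice
being given by `α`; likewise for `h` and `β`. The new distinguished point is `u` or `v`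
according to `γ`. The Boolean `true` stands for `u`. -/
structure IsGluing {A B C : Type} (e : B ⊕ C ≃ A) (α β : Option Bool) (γ : Bool)
    (g : B → Option B) (u : B) (h : C → Option C) (v : C) (f : A → Option A) (s : A) : Prop where
  left : ∀ b, f (e (.inl b)) =
    (g b).elim (α.map fun t => cond t (e (.inl u)) (e (.inr v))) fun y => some (e (.inl y))
  right : ∀ c, f (e (.inr c)) =
    (h c).elim (β.map fun t => cond t (e (.inl u)) (e (.inr v))) fun y => some (e (.inr y))
  point : s = cond γ (e (.inl u)) (e (.inr v))

section Gluing

variable {A B C : Type} {e : B ⊕ C ≃ A} {α β : Option Bool} {γ : Bool}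
    {g : B → Option B} {u : B} {h : C → Option C} {v : C} {f : A → Option A} {s : A}

theorem exists_sum_iff (e : B ⊕ C ≃ A) (P : A → Prop) :
    (∃ a, P a) ↔ (∃ b, P (e (.inl b))) ∨ ∃ c, P (e (.inr c)) := by
  rw [← e.exists_congr_right, Sum.exists]

theorem IsGluing.mtype_zero {ι : Type w} (H : IsGluing e α β γ g u h v f s) (X : ι → Set A) :
    mtype f s 0 X = AtomicType.glue α β γ
      (mtype g u 0 fun i => (fun b => e (.inl b)) ⁻¹' X i)
      (mtype h v 0 fun i => (fun c => e (.inr c)) ⁻¹' X i) := by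
  refine AtomicType.ext ?_ ?_ ?_ ?_ ?_
  · funext i j
    exact propext (exists_sum_iff e _)
  · funext i
    refine propext ⟨fun hs => ⟨fun x hx y hy => ?_, fun x hx y hy => ?_, ?_⟩, ?_⟩
    · simpa using hs hx hy
    · simpa using hs hx hy
    · by_contra! hc
      obtain ⟨⟨b, hb, -⟩, ⟨c, hc, -⟩⟩ := hc
      simpa using hs hb hc
    · rintro ⟨h1, h2, h3⟩ x hx y hy
      obtain ⟨x, rfl⟩ := e.surjective x
      obtain ⟨y, rfl⟩ := e.surjective y
      rcases x with x | x <;> rcases y with y | y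
      · rw [h1 hx hy]
      · exact (h3.elim (fun h => h ⟨x, hx, hx⟩) (fun h => h ⟨y, hy, hy⟩)).elim
      · exact (h3.elim (fun h => h ⟨y, hy, hy⟩) (fun h => h ⟨x, hx, hx⟩)).elim
      · rw [h2 hx hy]
  · funext i j
    refine propext ⟨?_, ?_⟩
    · rintro ⟨x, hx, y, hy, hxy⟩
      obtain ⟨x, rfl⟩ := e.surjective x
      rcases x with x | x
      · rw [H.left] at hxy
        rcases hg : g x with _ | z
        · rw [hg] at hxy
          rcases α with _ | t
          · simp at hxy
          · simp only [Option.elim_none, Option.map_some, Option.some.injEq] at hxy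
            refine Or.inr (Or.inr (Or.inl ⟨⟨x, hx, hg⟩, t, rfl, ?_⟩))
            subst hxy
            cases t <;> exact hy
        · rw [hg] at hxy
          simp only [Option.elim_some, Option.some.injEq] at hxy
          subst hxy
          exact Or.inl ⟨x, hx, z, hy, hg⟩
      · rw [H.right] at hxy
        rcases hg : h x with _ | z
        · rw [hg] at hxy
          rcases β with _ | t
          · simp at hxy
          · simp only [Option.elim_none, Option.map_some, Option.some.injEq] at hxy
            refine Or.inr (Or.inr (Or.inr ⟨⟨x, hx, hg⟩, t, rfl, ?_⟩))
            subst hxy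
            cases t <;> exact hy
        · rw [hg] at hxy
          simp only [Option.elim_some, Option.some.injEq] at hxy
          subst hxy
          exact Or.inr (Or.inl ⟨x, hx, z, hy, hg⟩)
    · rintro (⟨x, hx, y, hy, hxy⟩ | ⟨x, hx, y, hy, hxy⟩ | ⟨⟨x, hx, hn⟩, t, rfl, ht⟩ |
        ⟨⟨x, hx, hn⟩, t, rfl, ht⟩)
      · exact ⟨_, hx, _, hy, by rw [H.left, hxy]; rfl⟩
      · exact ⟨_, hx, _, hy, by rw [H.right, hxy]; rfl⟩
      · exact ⟨_, hx, cond t (e (.inl u)) (e (.inr v)), by cases t <;> exact ht,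
          by rw [H.left, hn]; rfl⟩
      · exact ⟨_, hx, cond t (e (.inl u)) (e (.inr v)), by cases t <;> exact ht,
          by rw [H.right, hn]; rfl⟩
  · funext i
    refine propext ((exists_sum_iff e _).trans (or_congr ?_ ?_))
    · constructor
      · rintro ⟨b, hb, hn⟩
        rw [H.left] at hn
        rcases hg : g b with _ | z
        · rw [hg] at hn
          exact ⟨⟨b, hb, hg⟩, by simpa using hn⟩
        · simp [hg] at hn
      · rintro ⟨⟨b, hb, hn⟩, rfl⟩
        exact ⟨b, hb, by rw [H.left, hn]; rfl⟩
    · constructor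
      · rintro ⟨b, hb, hn⟩
        rw [H.right] at hn
        rcases hg : h b with _ | z
        · rw [hg] at hn
          exact ⟨⟨b, hb, hg⟩, by simpa using hn⟩
        · simp [hg] at hn
      · rintro ⟨⟨b, hb, hn⟩, rfl⟩
        exact ⟨b, hb, by rw [H.right, hn]; rfl⟩
  · funext i
    rw [H.point]
    cases γ <;> rfl

/-- The composition theorem: subsets of a disjoint union are pairs of subsets of the parts, so the
`m`-type of a gluing is determined by the `m`-types of the parts. -/
theorem IsGluing.mtype_eq (H : IsGluing e α β γ g u h v f s) (m : ℕ) {ι : Type w}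
    (X : ι → Set A) :
    mtype f s m X = MType.glue α β γ m
      (mtype g u m fun i => (fun b => e (.inl b)) ⁻¹' X i)
      (mtype h v m fun i => (fun c => e (.inr c)) ⁻¹' X i) := by
  induction m generalizing ι with
  | zero => exact H.mtype_zero X
  | succ m ih =>
    have preimage_extend : ∀ {D : Type} (k : D → A) (Y : Set A),
        (fun o => k ⁻¹' extend X Y o) = extend (fun i => k ⁻¹' X i) (k ⁻¹' Y) := by
      intro D k Y
      funext o
      cases o <;> rfl
    refine Set.Subset.antisymm ?_ ?_
    · rintro _ ⟨Y, rfl⟩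
      refine ⟨_, ⟨(fun b => e (.inl b)) ⁻¹' Y, rfl⟩, _, ⟨(fun c => e (.inr c)) ⁻¹' Y, rfl⟩, ?_⟩
      beta_reduce
      rw [ih, preimage_extend, preimage_extend]
    · rintro _ ⟨_, ⟨Y, rfl⟩, _, ⟨Z, rfl⟩, rfl⟩
      refine ⟨{a | (e.symm a).elim Y Z}, ?_⟩
      beta_reduce
      rw [ih, preimage_extend, preimage_extend]
      congr 3
      · ext b
        simp only [mem_preimage, mem_ofPred_eq, Equiv.symm_apply_apply]
        rfl
      · ext b
        simp only [mem_preimage, mem_ofPred_eq, Equiv.symm_apply_apply]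
        rfl

end Gluing

/-! ### Decomposing finite unary functions -/

/-- The pointed partial functions obtained from one-element ones by repeated gluing. -/
inductive Constructible : {A : Type} → (A → Option A) → A → Prop
  | single {A : Type} (f : A → Option A) (s : A) (hA : Nat.card A = 1) : Constructible f s
  | glue {A B C : Type} {e : B ⊕ C ≃ A} {α β : Option Bool} {γ : Bool}
      {g : B → Option B} {u : B} {h : C → Option C} {v : C} {f : A → Option A} {s : A}
      (H : IsGluing e α β γ g u h v f s) (hg : Constructible g u) (hh : Constructible h v) :
      Constructible f s

section Decomposition

variable {A : Type}

open Classical in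
/-- The restriction of a partial function to a subset, undefined where the function leaves it. -/
noncomputable def restrict (f : A → Option A) (p : A → Prop) (x : {x // p x}) :
    Option {x // p x} :=
  (f x).bind fun y => if h : p y then some ⟨y, h⟩ else none

theorem restrict_eq_some {f : A → Option A} {p : A → Prop} {x y : {x // p x}} :
    restrict f p x = some y ↔ f x = some y.1 := by
  classical
  unfold restrict
  rcases h : f x with _ | z
  · simp
  · by_cases hz : p z
    · simp [hz, Subtype.ext_iff]
    · simp only [Option.bind_some, hz, dite_false, Option.some.injEq]
      constructor
      · simp
      · rintro rfl
        exact (hz y.2).elim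

theorem restrict_eq_none {f : A → Option A} {p : A → Prop} {x : {x // p x}} :
    restrict f p x = none ↔ ∀ y, f x = some y → ¬ p y := by
  classical
  unfold restrict
  rcases h : f x with _ | z
  · simp
  · by_cases hz : p z <;> simp [hz]

/-- A decomposition of the domain into two parts presents a partial function as a gluing, provided
that all values leaving a part are the distinguished point of the other part, and that no value is
undefined on a part which values leave. -/
theorem Constructible.of_restrict {f : A → Option A} {s : A} (p : A → Prop) (α β : Option Bool)
    (γ : Bool) {u : {x // p x}} {v : {x // ¬ p x}}
    (hu : Constructible (restrict f p) u) (hv : Constructible (restrict f fun x => ¬ p x) v)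
    (hp : ∀ x, p x → f x = none → α = none)
    (hp' : ∀ x y, p x → ¬ p y → f x = some y → α = some false ∧ y = v)
    (hq : ∀ x, ¬ p x → f x = none → β = none)
    (hq' : ∀ x y, ¬ p x → p y → f x = some y → β = some true ∧ y = u)
    (hs : s = cond γ u.1 v.1) : Constructible f s := by
  classical
  refine .glue (e := Equiv.sumCompl p) (α := α) (β := β) (γ := γ) ⟨?_, ?_, ?_⟩ hu hv
  · intro b
    rw [Equiv.sumCompl_apply_inl]
    rcases hb : restrict f p b with _ | y
    · rw [restrict_eq_none] at hb
      rcases hf : f b with _ | z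
      · rw [hp b b.2 hf]; rfl
      · obtain ⟨rfl, rfl⟩ := hp' b z b.2 (hb z hf) hf
        rfl
    · rw [restrict_eq_some.1 hb]; rfl
  · intro b
    rw [Equiv.sumCompl_apply_inr]
    rcases hb : restrict f (fun x => ¬ p x) b with _ | y
    · rw [restrict_eq_none] at hb
      rcases hf : f b with _ | z
      · rw [hq b b.2 hf]; rfl
      · obtain ⟨rfl, rfl⟩ := hq' b z b.2 (not_not.1 (hb z hf)) hf
        rfl
    · rw [restrict_eq_some.1 hb]; rfl
  · rw [hs]; rfl

/-- A single element `r` can be split off if the function is defined at all other elements: the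
values leaving the rest are then all equal to `r`. -/
theorem Constructible.of_restrict_ne {f : A → Option A} {s r : A} (β : Option Bool) (γ : Bool)
    {u : {x // x ≠ r}} (hu : Constructible (restrict f (· ≠ r)) u)
    (hf : ∀ x, f x = none → x = r)
    (hr : f r = none → β = none) (hr' : ∀ y, y ≠ r → f r = some y → β = some true ∧ y = u)
    (hs : s = cond γ u.1 r) : Constructible f s := by
  have : Nat.card {x // ¬ x ≠ r} = 1 := by
    simp only [ne_eq, not_not]
    exact Nat.card_unique
  refine .of_restrict (· ≠ r) (some false) β γ (v := ⟨r, by simp⟩) hu (.single _ _ this)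
    ?_ ?_ ?_ ?_ hs
  · exact fun x hx h => (hx (hf x h)).elim
  · exact fun x y _ hy _ => ⟨rfl, not_not.1 hy⟩
  · intro x hx h
    obtain rfl := not_not.1 hx
    exact hr h
  · intro x y hx hy h
    obtain rfl := not_not.1 hx
    exact hr' y hy h

/-- Finite forests are constructible with an arbitrary distinguished point. A tree is its root glued
to the forest of its proper subtrees, and a forest with at least two roots is a disjoint union. -/
theorem constructible_of_rank [Finite A] (f : A → Option A) (s : A) (rank : A → ℕ)
    (hrank : ∀ x y, f x = some y → rank y < rank x) : Constructible f s := by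
  induction hn : Nat.card A using Nat.strong_induction_on generalizing A with
  | _ n ih =>
  have ih' : ∀ (p : A → Prop) (u : {x // p x}), (∃ x, ¬ p x) → Constructible (restrict f p) u := by
    rintro p u ⟨x, hx⟩
    refine ih _ ?_ (restrict f p) u (fun x => rank x) ?_ rfl
    · rw [← hn]
      exact Finite.card_subtype_lt hx
    · exact fun x y h => hrank _ _ (restrict_eq_some.1 h)
  have : Nonempty A := ⟨s⟩
  obtain ⟨r, hr⟩ := Finite.exists_min rank
  have hr : f r = none := by
    rcases h : f r with _ | y
    · rfl
    · exact absurd (hrank _ _ h) (not_lt.2 (hr y))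
  by_cases hroot : ∀ x, f x = none → x = r
  · by_cases hsr : s = r
    · by_cases hA : ∃ x, x ≠ r
      · obtain ⟨x, hx⟩ := hA
        exact .of_restrict_ne none false (ih' (· ≠ r) ⟨x, hx⟩ ⟨r, by simp⟩) hroot (fun _ => rfl)
          (by simp [hr]) hsr
      · push Not at hA
        have : Unique A := ⟨⟨r⟩, hA⟩
        exact .single _ _ Nat.card_unique
    · exact .of_restrict_ne none true (ih' (· ≠ r) ⟨s, hsr⟩ ⟨r, by simp⟩) hroot (fun _ => rfl)
        (by simp [hr]) rfl
  · push Not at hroot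
    obtain ⟨r', hr', hne⟩ := hroot
    let p : A → Prop := fun x => Relation.ReflTransGen (fun x y => f x = some y) x r
    have p_of_ne : ∀ x, p x → x ≠ r → ∃ y, f x = some y ∧ p y := by
      intro x hx hxr
      rcases hx.cases_head with h | ⟨y, hy, h⟩
      · exact (hxr h).elim
      · exact ⟨y, hy, h⟩
    have hp : p r := .refl
    have hp' : ¬ p r' := fun h => by
      obtain ⟨y, hy, -⟩ := p_of_ne _ h hne
      simp [hr'] at hy
    have split : ∀ (u : {x // p x}) (v : {x // ¬ p x}) (γ : Bool), s = cond γ u.1 v.1 →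
        Constructible f s := by
      intro u v γ hs
      refine .of_restrict p none none γ (ih' p u ⟨r', hp'⟩)
        (ih' (fun x => ¬ p x) v ⟨r, not_not.2 hp⟩) (fun _ _ _ => rfl) ?_ (fun _ _ _ => rfl) ?_ hs
      · intro x y hx hy h
        obtain ⟨z, hz, hpz⟩ := p_of_ne x hx (by rintro rfl; simp [hr] at h)
        rw [h, Option.some.injEq] at hz
        exact (hy (hz ▸ hpz)).elim
      · exact fun x y hx hy h => (hx (.head h hy)).elim
    by_cases hs : p s
    · exact split ⟨s, hs⟩ ⟨r', hp'⟩ true rfl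
    · exact split ⟨r, hp⟩ ⟨s, hs⟩ false rfl

/-- If every element reaches `r`, then removing `r` leaves a forest, from which the function is
recovered by gluing `r` back in; marking the value at `r` in the forest closes the cycle. -/
theorem constructible_of_forall_reach [Finite A] (f : A → A) (r : A)
    (hr : ∀ x, ∃ n, f^[n] x = r) : ∃ s, Constructible (fun x => some (f x)) s := by
  classical
  have forest : ∀ u, Constructible (restrict (fun x => some (f x)) (· ≠ r)) u := by
    intro u
    refine constructible_of_rank _ u (fun x => Nat.find (hr x)) fun x y h => ?_
    rw [restrict_eq_some, Option.some.injEq] at h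
    have hx := Nat.find_spec (hr x)
    rcases hn : Nat.find (hr x) with _ | n
    · rw [hn] at hx
      exact (x.2 hx).elim
    · rw [hn, Function.iterate_succ_apply, h] at hx
      exact Nat.lt_succ_of_le (Nat.find_le hx)
  by_cases hA : ∃ x, x ≠ r
  · obtain ⟨u, hu⟩ : ∃ u : {x // x ≠ r}, f r ≠ r → f r = u := by
      by_cases h : f r = r
      · exact ⟨⟨_, hA.choose_spec⟩, fun h' => (h' h).elim⟩
      · exact ⟨⟨_, h⟩, fun _ => rfl⟩
    refine ⟨u, .of_restrict_ne (some true) true (forest u) (by simp) (by simp) ?_ rfl⟩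
    rintro y hy h
    rw [Option.some.injEq] at h
    subst h
    exact ⟨rfl, hu hy⟩
  · push Not at hA
    have : Unique A := ⟨⟨r⟩, hA⟩
    exact ⟨r, .single _ _ Nat.card_unique⟩

theorem exists_constructible [Finite A] [Nonempty A] (f : A → A) :
    ∃ s, Constructible (fun x => some (f x)) s := by
  induction hn : Nat.card A using Nat.strong_induction_on generalizing A with
  | _ n ih =>
  -- Some element `r` lies on a cycle, so the elements reaching `r` are closed under `f`.
  obtain ⟨r, k, hk⟩ : ∃ r k, f^[k + 1] r = r := by
    obtain ⟨a⟩ := ‹Nonempty A›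
    obtain ⟨i, j, hij, h⟩ := Finite.exists_ne_map_eq_of_infinite fun n => f^[n] a
    wlog hlt : i < j generalizing i j
    · exact this j i hij.symm h.symm (by omega)
    refine ⟨f^[i] a, j - i - 1, ?_⟩
    rw [← Function.iterate_add_apply, show j - i - 1 + 1 + i = j by omega]
    exact h.symm
  let p : A → Prop := fun x => ∃ n, f^[n] x = r
  have p_iff : ∀ x, p (f x) ↔ p x := by
    refine fun x => ⟨fun ⟨n, h⟩ => ⟨n + 1, h⟩, ?_⟩
    rintro ⟨n, h⟩
    refine ⟨k + n, ?_⟩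
    rw [← Function.iterate_succ_apply, show (k + n).succ = (k + 1) + n by omega,
      Function.iterate_add_apply, h, hk]
  by_cases hp : ∀ x, p x
  · exact constructible_of_forall_reach f r hp
  · push Not at hp
    obtain ⟨z, hz⟩ := hp
    have part : ∀ q : A → Prop, (∀ x, q x → q (f x)) → (∃ x, q x) → (∃ x, ¬ q x) →
        ∃ u, Constructible (restrict (fun x => some (f x)) q) u := by
      rintro q hq ⟨x, hx⟩ ⟨y, hy⟩
      have : Nonempty {x // q x} := ⟨⟨x, hx⟩⟩
      obtain ⟨u, hu⟩ := ih _ (by rw [← hn]; exact Finite.card_subtype_lt hy)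
        (fun x : {x // q x} => (⟨f x, hq x x.2⟩ : {x // q x})) rfl
      refine ⟨u, ?_⟩
      convert hu using 1
      funext x
      rw [restrict_eq_some]
    obtain ⟨u, hu⟩ := part p (fun x => (p_iff x).2) ⟨r, 0, rfl⟩ ⟨z, hz⟩
    obtain ⟨v, hv⟩ := part (fun x => ¬ p x) (fun x => mt (p_iff x).1) ⟨z, hz⟩
      ⟨r, not_not.2 ⟨0, rfl⟩⟩
    refine ⟨u, .of_restrict p none none true hu hv (fun _ _ _ => rfl) ?_ (fun _ _ _ => rfl) ?_ rfl⟩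
    · rintro x y hx hy h
      rw [Option.some.injEq] at h
      exact (hy (h ▸ (p_iff x).2 hx)).elim
    · rintro x y hx hy h
      rw [Option.some.injEq] at h
      exact (hx ((p_iff x).1 (h ▸ hy))).elim

end Decomposition

/-! ### Types generated by gluing -/

/-- The `m`-types realized on one-element sets. -/
def singletonTypes (m : ℕ) (ι : Type w) : Set (MType m ι) :=
  {t | ∃ (A : Type) (f : A → Option A) (s : A) (X : ι → Set A), Nat.card A = 1 ∧
    mtype f s m X = t}

/-- `GluingGen m ι t n` says that `t` is obtained from `n` types of one-element sets by gluing. -/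
abbrev GluingGen (m : ℕ) (ι : Type w) : MType m ι → ℕ → Prop :=
  Gen (singletonTypes m ι) fun (o : Option Bool × Option Bool × Bool) a b =>
    MType.glue o.1 o.2.1 o.2.2 m a b

theorem Constructible.gluingGen {A : Type} {f : A → Option A} {s : A} (h : Constructible f s)
    (m : ℕ) (ι : Type w) :
    Finite A ∧ ∀ X : ι → Set A, GluingGen m ι (mtype f s m X) (Nat.card A) := by
  induction h with
  | single f s hA =>
    refine ⟨Nat.finite_of_card_ne_zero (by omega), fun X => ?_⟩
    rw [hA]
    exact .leaf ⟨_, f, s, X, hA, rfl⟩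
  | @glue A B C e α β γ g u h v f s H _ _ ihg ihh =>
    obtain ⟨_, ihg⟩ := ihg
    obtain ⟨_, ihh⟩ := ihh
    refine ⟨Finite.of_equiv _ e, fun X => ?_⟩
    rw [H.mtype_eq, ← Nat.card_congr e, Nat.card_sum]
    exact .node (α, β, γ) (ihg _) (ihh _)

theorem exists_mtype_eq_of_gluingGen {m : ℕ} {ι : Type w} {t : MType m ι} {n : ℕ}
    (h : GluingGen m ι t n) :
    ∃ (A : Type) (_ : Finite A) (f : A → Option A) (s : A) (X : ι → Set A),
      Nat.card A = n ∧ mtype f s m X = t := by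
  induction h with
  | leaf h =>
    obtain ⟨A, f, s, X, hA, rfl⟩ := h
    exact ⟨A, Nat.finite_of_card_ne_zero (by omega), f, s, X, hA, rfl⟩
  | node o _ _ iha ihb =>
    obtain ⟨B, _, g, u, Y, hB, rfl⟩ := iha
    obtain ⟨C, _, h, v, Z, hC, rfl⟩ := ihb
    obtain ⟨α, β, γ⟩ := o
    let port : Bool → B ⊕ C := fun t => cond t (.inl u) (.inr v)
    let f : B ⊕ C → Option (B ⊕ C) := Sum.elim
      (fun b => (g b).elim (α.map port) fun y => some (.inl y))
      (fun c => (h c).elim (β.map port) fun y => some (.inr y))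
    have H : IsGluing (Equiv.refl _) α β γ g u h v f (port γ) :=
      ⟨fun _ => rfl, fun _ => rfl, rfl⟩
    refine ⟨B ⊕ C, inferInstance, f, port γ, fun i => {a | a.elim (Y i) (Z i)}, ?_, ?_⟩
    · rw [Nat.card_sum, hB, hC]
    · exact H.mtype_eq m _

/-! ### Types determine the truth of formulas -/

section Adequacy

variable {L : FirstOrder.Language.{u, v}} [Unique (L.Functions 1)]

/-- The interpretation of the unary function symbol, as a partial function. -/
def funOf (L : FirstOrder.Language.{u, v}) [Unique (L.Functions 1)] (M : Type) [L.Structure M]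
    (a : M) : Option M :=
  some (Language.Structure.funMap (default : L.Functions 1) fun _ => a)

/-- Sufficiently equivalent tuples can be extended by the value of a term. The set of that value is
named by the index `c`, and the old indices are embedded by `g`. -/
theorem exists_mtype_term (hfun : ∀ l : ℕ, l ≠ 1 → IsEmpty (L.Functions l)) {n : ℕ}
    (t : L.Term (Fin n)) :
    ∃ d : ℕ, ∀ (m : ℕ) (M M' : Type) [L.Structure M] [L.Structure M'] (s : M) (s' : M')
      (ι : Type w) (X : ι → Set M) (X' : ι → Set M') (x : Fin n → M) (x' : Fin n → M')
      (τ : Fin n → ι), (∀ i, X (τ i) = {x i}) → (∀ i, X' (τ i) = {x' i}) →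
      mtype (funOf L M) s (m + d) X = mtype (funOf L M') s' (m + d) X' →
      ∃ (κ : Type w) (Y : κ → Set M) (Y' : κ → Set M') (g : ι → κ) (c : κ),
        Y ∘ g = X ∧ Y' ∘ g = X' ∧ Y c = {t.realize x} ∧ Y' c = {t.realize x'} ∧
        mtype (funOf L M) s m Y = mtype (funOf L M') s' m Y' := by
  induction t with
  | var i =>
    refine ⟨0, fun m M M' _ _ s s' ι X X' x x' τ hτ hτ' h => ?_⟩
    exact ⟨ι, X, X', id, τ i, rfl, rfl, hτ i, hτ' i, h⟩
  | @func l F ts ih =>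
    by_cases hl : l = 1
    · subst hl
      obtain ⟨d, hd⟩ := ih 0
      refine ⟨1 + d, fun m M M' _ _ s s' ι X X' x x' τ hτ hτ' h => ?_⟩
      obtain ⟨κ, Y, Y', g, c, rfl, rfl, hc, hc', hY⟩ :=
        hd (m + 1) M M' s s' ι X X' x x' τ hτ hτ' (by rw [add_assoc]; exact h)
      have realize_eq : ∀ (N : Type) [L.Structure N] (y : Fin n → N),
          funOf L N ((ts 0).realize y) = some ((Language.Term.func F ts).realize y) := by
        intro N _ y
        rw [funOf, Language.Term.realize_func, Unique.eq_default F]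
        congr 2
        funext i
        rw [Subsingleton.elim i 0]
      obtain ⟨B, hB⟩ := mtype_forth hY {(Language.Term.func F ts).realize x}
      obtain ⟨b, hb⟩ := exists_eq_singleton hB (i := none) rfl
      have he := (edge_iff hB (some c) none).1
        ⟨_, hc.ge rfl, _, rfl, realize_eq M x⟩
      obtain ⟨y, hy, z, hz, hyz⟩ := he
      have hy : y ∈ Y' c := hy
      rw [hc'] at hy
      rw [hb] at hz
      obtain rfl : y = _ := hy
      obtain rfl : z = b := hz
      rw [realize_eq, Option.some.injEq] at hyz
      exact ⟨Option κ, _, _, some ∘ g, none, rfl, rfl, rfl, by rw [hb, hyz], hB⟩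
    · exact ((hfun l hl).false F).elim

/-- The truth of a formula is determined by the `m`-type, for some `m`, of a tuple of sets
containing the interpretations of the relation symbols of the formula, the values of the free set
variables, and the singletons of the values of the free individual variables. -/
theorem exists_realize_iff (hrel : ∀ l : ℕ, l ≠ 1 → IsEmpty (L.Relations l))
    (hfun : ∀ l : ℕ, l ≠ 1 → IsEmpty (L.Functions l)) {n k : ℕ} (φ : MSOFormula L n k) :
    ∃ (S : Set (L.Relations 1)) (m : ℕ), S.Finite ∧
      ∀ (M M' : Type) [L.Structure M] [L.Structure M'] (s : M) (s' : M')
      (ι : Type w) (X : ι → Set M) (X' : ι → Set M') (x : Fin n → M) (x' : Fin n → M')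
      (P : Fin k → Set M) (P' : Fin k → Set M') (τ : Fin n → ι) (σ : Fin k → ι) (ρ : S → ι),
      (∀ i, X (τ i) = {x i}) → (∀ i, X' (τ i) = {x' i}) →
      (∀ i, X (σ i) = P i) → (∀ i, X' (σ i) = P' i) →
      (∀ R, X (ρ R) = {a | Language.Structure.RelMap R.1 fun _ => a}) →
      (∀ R, X' (ρ R) = {a | Language.Structure.RelMap R.1 fun _ => a}) →
      mtype (funOf L M) s m X = mtype (funOf L M') s' m X' →
      (φ.Realize x P ↔ φ.Realize x' P') := by
  induction φ with
  | falsum =>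
    exact ⟨∅, 0, finite_empty, by intros; exact Iff.rfl⟩
  | equal t₁ t₂ =>
    obtain ⟨d₁, h₁⟩ := exists_mtype_term.{u, v, w} hfun t₁
    obtain ⟨d₂, h₂⟩ := exists_mtype_term.{u, v, w} hfun t₂
    refine ⟨∅, 0 + d₂ + d₁, finite_empty, ?_⟩
    intro M M' _ _ s s' ι X X' x x' P P' τ σ ρ hτ hτ' _ _ _ _ h
    obtain ⟨κ, Y, Y', g, c, rfl, rfl, hc, hc', hY⟩ := h₁ _ M M' s s' ι X X' x x' τ hτ hτ' h
    obtain ⟨κ', Z, Z', g', c', rfl, rfl, hd, hd', hZ⟩ :=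
      h₂ _ M M' s s' κ Y Y' x x' (g ∘ τ) hτ hτ' hY
    have := meet_iff hZ (g' c) c'
    simp only [Function.comp_apply] at hc hc'
    rw [hc, hc', hd, hd'] at this
    simpa [MSOFormula.Realize, eq_comm] using this
  | mem t j =>
    obtain ⟨d, h₁⟩ := exists_mtype_term.{u, v, w} hfun t
    refine ⟨∅, 0 + d, finite_empty, ?_⟩
    intro M M' _ _ s s' ι X X' x x' P P' τ σ ρ hτ hτ' hσ hσ' _ _ h
    obtain ⟨κ, Y, Y', g, c, rfl, rfl, hc, hc', hY⟩ := h₁ _ M M' s s' ι X X' x x' τ hτ hτ' h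
    have := meet_iff hY c (g (σ j))
    have e₁ : Y (g (σ j)) = P j := hσ j
    have e₂ : Y' (g (σ j)) = P' j := hσ' j
    rw [hc, hc', e₁, e₂, singleton_inter_nonempty, singleton_inter_nonempty] at this
    exact this
  | @rel n k l R ts =>
    by_cases hl : l = 1
    · subst hl
      obtain ⟨d, h₁⟩ := exists_mtype_term.{u, v, w} hfun (ts 0)
      refine ⟨{R}, 0 + d, finite_singleton R, ?_⟩
      intro M M' _ _ s s' ι X X' x x' P P' τ σ ρ hτ hτ' _ _ hρ hρ' h
      obtain ⟨κ, Y, Y', g, c, rfl, rfl, hc, hc', hY⟩ := h₁ _ M M' s s' ι X X' x x' τ hτ hτ' h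
      have := meet_iff hY c (g (ρ ⟨R, rfl⟩))
      have e₁ := hρ ⟨R, rfl⟩
      have e₂ := hρ' ⟨R, rfl⟩
      simp only [Function.comp_apply] at e₁ e₂
      rw [hc, hc', e₁, e₂, singleton_inter_nonempty, singleton_inter_nonempty] at this
      have args : ∀ (N : Type) [L.Structure N] (y : Fin n → N),
          (fun i => (ts i).realize y) = fun _ => (ts 0).realize y := by
        intro N _ y
        funext i
        rw [Subsingleton.elim i 0]
      rw [MSOFormula.Realize, MSOFormula.Realize, args, args]
      exact this
    · exact ((hrel l hl).false R).elim
  | imp φ ψ ihφ ihψ =>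
    obtain ⟨S, m, hS, h₁⟩ := ihφ
    obtain ⟨S', m', hS', h₂⟩ := ihψ
    refine ⟨S ∪ S', max m m', hS.union hS', ?_⟩
    intro M M' _ _ s s' ι X X' x x' P P' τ σ ρ hτ hτ' hσ hσ' hρ hρ' h
    exact imp_congr
      (h₁ M M' s s' ι X X' x x' P P' τ σ (fun R => ρ ⟨R, Or.inl R.2⟩) hτ hτ' hσ hσ'
        (fun R => hρ _) (fun R => hρ' _) (mtype_of_le (le_max_left _ _) h))
      (h₂ M M' s s' ι X X' x x' P P' τ σ (fun R => ρ ⟨R, Or.inr R.2⟩) hτ hτ' hσ hσ'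
        (fun R => hρ _) (fun R => hρ' _) (mtype_of_le (le_max_right _ _) h))
  | @all n k φ ih =>
    obtain ⟨S, m, hS, ih⟩ := ih
    refine ⟨S, m + 1, hS, ?_⟩
    intro M M' _ _ s s' ι X X' x x' P P' τ σ ρ hτ hτ' hσ hσ' hρ hρ' h
    have step : ∀ (a : M) (a' : M'),
        mtype (funOf L M) s m (extend X {a}) = mtype (funOf L M') s' m (extend X' {a'}) →
        (φ.Realize (Fin.snoc (α := fun _ : Fin (n + 1) => M) x a) P ↔
          φ.Realize (Fin.snoc (α := fun _ : Fin (n + 1) => M') x' a') P') := by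
      intro a a' ha
      refine ih M M' s s' (Option ι) _ _ _ _ P P'
        (Fin.snoc (α := fun _ : Fin (n + 1) => Option ι) (some ∘ τ) none) (some ∘ σ) (some ∘ ρ)
        ?_ ?_ hσ hσ' hρ hρ' ha
      · refine Fin.lastCases ?_ fun i => ?_
        · simp [extend]
        · simpa [extend] using hτ i
      · refine Fin.lastCases ?_ fun i => ?_
        · simp [extend]
        · simpa [extend] using hτ' i
    constructor
    · intro hφ a'
      obtain ⟨B, hB⟩ := mtype_forth h.symm {a'}
      obtain ⟨a, ha⟩ := exists_eq_singleton hB (i := none) rfl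
      obtain rfl : B = {a} := ha
      exact (step a a' hB.symm).1 (hφ a)
    · intro hφ a
      obtain ⟨B, hB⟩ := mtype_forth h {a}
      obtain ⟨a', ha⟩ := exists_eq_singleton hB (i := none) rfl
      obtain rfl : B = {a'} := ha
      exact (step a a' hB).2 (hφ a')
  | @allSet n k φ ih =>
    obtain ⟨S, m, hS, ih⟩ := ih
    refine ⟨S, m + 1, hS, ?_⟩
    intro M M' _ _ s s' ι X X' x x' P P' τ σ ρ hτ hτ' hσ hσ' hρ hρ' h
    have step : ∀ (B : Set M) (B' : Set M'),
        mtype (funOf L M) s m (extend X B) = mtype (funOf L M') s' m (extend X' B') →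
        (φ.Realize x (Fin.snoc (α := fun _ : Fin (k + 1) => Set M) P B) ↔
          φ.Realize x' (Fin.snoc (α := fun _ : Fin (k + 1) => Set M') P' B')) := by
      intro B B' hB
      refine ih M M' s s' (Option ι) _ _ x x' _ _ (some ∘ τ)
        (Fin.snoc (α := fun _ : Fin (k + 1) => Option ι) (some ∘ σ) none) (some ∘ ρ)
        hτ hτ' ?_ ?_ hρ hρ' hB
      · refine Fin.lastCases ?_ fun i => ?_
        · simp [extend]
        · simpa [extend] using hσ i
      · refine Fin.lastCases ?_ fun i => ?_
        · simp [extend]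
        · simpa [extend] using hσ' i
    constructor
    · intro hφ B'
      obtain ⟨B, hB⟩ := mtype_forth h.symm B'
      exact (step B B' hB.symm).1 (hφ B)
    · intro hφ B
      obtain ⟨B', hB⟩ := mtype_forth h B
      exact (step B B' hB).2 (hφ B')

end Adequacy

/-! ### Pumping models -/

/-- The structure in which every unary function symbol is interpreted by `f`, and every unary
relation symbol `R` by `Q R`. Symbols of other arities get values of no significance. -/
@[reducible]
def unaryStructure (L : FirstOrder.Language.{u, v}) {A : Type} (s : A) (f : A → A)
    (Q : L.Relations 1 → Set A) : L.Structure A where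
  funMap {l} _ a := match l, a with
    | 0, _ => s
    | _ + 1, a => f (a 0)
  RelMap {l} R a := match l, R, a with
    | 1, R, a => a 0 ∈ Q R
    | _, _, _ => False

end MSO

open MSO in
theorem mainTheorem1 (L : FirstOrder.Language.{u, v})
    (hrel : ∀ l : ℕ, l ≠ 1 → IsEmpty (L.Relations l))
    (hfun : ∀ l : ℕ, l ≠ 1 → IsEmpty (L.Functions l))
    [Unique (L.Functions 1)]
    {n k : ℕ} (φ : MSO.MSOFormula L n k) :
    MSO.EventuallyPeriodic φ.spectrum := by
  classical
  obtain ⟨S, m, hS, hφ⟩ := exists_realize_iff.{u, v, v} hrel hfun φ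
  have := hS.to_subtype
  let ι : Type v := S ⊕ Fin k ⊕ Fin n
  -- The extra quantifier makes the totality of the function part of the type.
  obtain ⟨θ, p, hp, hpump⟩ := exists_forall_gen_add (singletonTypes (m + 1) ι)
    fun (o : Option Bool × Option Bool × Bool) a b => MType.glue o.1 o.2.1 o.2.2 (m + 1) a b
  refine ⟨θ, p, hp, ?_⟩
  rintro c hc ⟨M, _, _, _, x, P, hM, rfl⟩
  obtain ⟨s, hs⟩ := exists_constructible fun a : M =>
    FirstOrder.Language.Structure.funMap (default : L.Functions 1) fun _ => a
  let X : ι → Set M := Sum.elim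
    (fun R => {a | FirstOrder.Language.Structure.RelMap R.1 fun _ => a})
    (Sum.elim P fun i => {x i})
  obtain ⟨A, _, f, s', X', hA, hX⟩ :=
    exists_mtype_eq_of_gluingGen (hpump _ _ hc ((hs.gluingGen (m + 1) ι).2 X))
  have hX : mtype f s' (m + 1) X' = mtype (funOf L M) s (m + 1) X := hX
  have total : ∀ a, ∃ b, f a = some b := by
    intro a
    obtain ⟨B, hB⟩ := mtype_forth hX Set.univ
    by_contra! hn
    obtain ⟨b, -, hb⟩ := (undef_iff hB none).1
      ⟨a, Set.mem_univ a, Option.eq_none_iff_forall_ne_some.2 hn⟩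
    exact Option.some_ne_none _ hb
  choose f₀ hf₀ using total
  have hx : ∀ i, ∃ a, X' (.inr (.inr i)) = {a} := fun i =>
    exists_eq_singleton hX.symm (i := .inr (.inr i)) (a := x i) rfl
  choose x' hx' using hx
  let _ : L.Structure A := unaryStructure L s' f₀ fun R =>
    if h : R ∈ S then X' (.inl ⟨R, h⟩) else ∅
  have hf : f = funOf L A := funext hf₀
  refine ⟨A, ⟨s'⟩, inferInstance, inferInstance, x', fun i => X' (.inr (.inl i)), ?_, hA⟩
  refine (hφ M A s s' ι X X' x x' P _ (fun i => .inr (.inr i)) (fun i => .inr (.inl i))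
    Sum.inl (fun _ => rfl) hx' (fun _ => rfl) (fun _ => rfl) (fun _ => rfl) ?_ ?_).1 hM
  · rintro ⟨R, hR⟩
    ext a
    change a ∈ X' (.inl ⟨R, hR⟩) ↔ a ∈ if h : R ∈ S then X' (.inl ⟨R, h⟩) else ∅
    rw [dif_pos hR]
  · rw [← hf]
    exact mtype_of_succ hX.symm
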